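/- Let $d\ge 1$, $0<s\le 1$, $T>0$, and let $\Omega\subset\mathbb{R}^d$ be a bounded open set (for example a bounded Lipschitz domain). For $\varphi\in C_c^\infty(\mathbb{R}^d)$ and $0<s<1$ let $$D^s\varphi(x)=c_{d,s}\int_{\mathbb{R}^d}\frac{\varphi(x)-\varphi(y)}{|x-y|^{d+s}}\frac{x-y}{|x-y|}\,dy,\qquad c_{d,s}=2^s\pi^{-d/2}\frac{\Gamma(\frac{d+s+1}{2})}{\Gamma(\frac{1-s}{2})},$$ and let $D^1$ be the gradient. Let $H^s_0(\Omega)$ and $H^s(\mathbb{R}^d)$ be the closures of $C_c^\infty(\Omega)$ and $C_c^\infty(\mathbb{R}^d)$ in the norm $(\|u\|_{L^2(\mathbb{R}^d)}^2+\|D^su\|_{L^2(\mathbb{R}^d)^d}^2)^{1/2}$, functions in $H^s_0(\Omega)$ being extended by $0$. Let $A$ be a measurable symmetric matrix field on $\mathbb{R}^d$ with $a_*|z|^2\le A(x)z\cdot z\le a^*|z|^2$ for a.e. $x$ and all $z\in\mathbb{R}^d$, where $a_*>0$; put $\langle\mathcal{L}_A^su,v\rangle=[u,v]_A=\int_{\mathbb{R}^d}AD^su\cdot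 D^sv$. Let $H^{-s}(\Omega)$ be the dual of $H^s_0(\Omega)$, with the norm dual to $[v,v]_A^{1/2}$, that is, $\|F\|_{H^{-s}(\Omega)}=\sup\{|\langle F,v\rangle|: v\in H^s_0(\Omega),\ [v,v]_A\le 1\}$; $L^2(\Omega)$ is embedded in $H^{-s}(\Omega)$ by $\langle h,v\rangle=\int_\Omega hv$. Let $\gamma:\mathbb{R}\to\mathbb{R}$ be nondecreasing and Lipschitz with constant $C_\gamma$, with $\gamma(0)=0$ and $\liminf_{|r|\to\infty}\gamma(r)/r>0$. Let $\tilde g\in BV(0,T;L^2(\Omega))\cap L^2(0,T;H^s(\mathbb{R}^d))$, and for a.e. $t$ let $g(t)\in H^s(\mathbb{R}^d)$ satisfy $g(t)=\tilde g(t)$ a.e. in $\mathbb{R}^d\setminus\Omega$ and $[g(t),v]_A=0$ for all $v\in H^s_0(\Omega)$. For $f\in L^2(0,T;H^{-s}(\Omega))$ and $\eta_0\in L^2(\Omega)$, a generalised enthalpy solution with data $(f,g,\eta_0)$ is a function $\eta\in L^2(0,T;L^2(\Omega))\cap H^1(0,T;H^{-s}(\Omega))$ such that $\gamma(\eta)-g\in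 L^2(0,T;H^s_0(\Omega))$, $\eta(0)=\eta_0$ in $H^{-s}(\Omega)$, and $$\int_0^T\Big\langle\frac{d\eta}{dt},\xi\Big\rangle dt+\int_0^T[\gamma(\eta)-g,\xi]_A\,dt=\int_0^T\langle f,\xi\rangle\,dt\qquad\text{for all }\xi\in L^2(0,T;H^s_0(\Omega)).$$ For $t\in[0,T]$, $\eta(t)$ denotes the value of the continuous representative of $\eta$ in $H^{-s}(\Omega)$, and $\vartheta=\gamma(\eta)$. Let $f,\hat f\in L^2(0,T;H^{-s}(\Omega))$ and $\eta_0,\hat\eta_0\in L^2(\Omega)$, and let $\eta,\hat\eta$ be generalised enthalpy solutions with data $(f,g,\eta_0)$ and $(\hat f,g,\hat\eta_0)$, with $\vartheta=\gamma(\eta)$, $\hat\vartheta=\gamma(\hat\eta)$. Then, for all $0\le t\le T$, $$\|\eta(t)-\hat\eta(t)\|_{H^{-s}(\Omega)}\le\|\eta_0-\hat\eta_0\|_{H^{-s}(\Omega)}+\int_0^t\|f(\tau)-\hat f(\tau)\|_{H^{-s}(\Omega)}\,d\tau,$$ and $$\|\vartheta-\hat\vartheta\|_{L^2(0,T;L^2(\Omega))}\le\sqrt{C_\gamma}\,\|\eta_0-\hat\eta_0\|_{H^{-s}(\Omega)}+\sqrt{\tfrac{3C_\gamma}{2}}\,\|f-\hat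 f\|_{L^1(0,T;H^{-s}(\Omega))}.$$ -/

import Mathlib

open MeasureTheory Set
open scoped ENNReal NNReal ContDiff

noncomputable section

namespace FracStefan

/-- `ℝ^d` with the Euclidean norm. -/
abbrev Rd (d : ℕ) : Type := EuclideanSpace ℝ (Fin d)

/-- `L²(Ω)`. -/
abbrev L2 {d : ℕ} (Ω : Set (Rd d)) : Type := Lp ℝ 2 (volume.restrict Ω)

/-- `L²(ℝ^d) × L²(ℝ^d)^d` with the Hilbert norm `(‖u‖² + ‖U‖²)^{1/2}`. A function `u ∈ H^s(ℝ^d)`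
is represented by the pair `(u, D^s u)`, so that this norm is its graph norm. -/
abbrev Pairs (d : ℕ) : Type :=
  WithLp 2 (Lp ℝ 2 (volume : Measure (Rd d)) × Lp (Rd d) 2 (volume : Measure (Rd d)))

/-- The normalisation constant `c_{d,s}` of the Riesz fractional gradient. -/
def rieszConst (d : ℕ) (s : ℝ) : ℝ :=
  2 ^ s * Real.pi ^ (-(d : ℝ) / 2) * Real.Gamma (((d : ℝ) + s + 1) / 2) / Real.Gamma ((1 - s) / 2)

/-- The Riesz fractional gradient `D^s φ` of a test function for `0 < s < 1`, in integral form;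
for `s = 1` it is the classical gradient. -/
def fracGrad {d : ℕ} (s : ℝ) (φ : Rd d → ℝ) (x : Rd d) : Rd d :=
  if s = 1 then gradient φ x
  else rieszConst d s •
    ∫ y, ((φ x - φ y) / ‖x - y‖ ^ ((d : ℝ) + s)) • (‖x - y‖⁻¹ • (x - y))

/-- The pairs `(φ, D^s φ)` with `φ ∈ C_c^∞(Ω)`. -/
def testPairs {d : ℕ} (s : ℝ) (Ω : Set (Rd d)) : Set (Pairs d) :=
  {p | ∃ φ : Rd d → ℝ, ContDiff ℝ ∞ φ ∧ HasCompactSupport φ ∧ tsupport φ ⊆ Ω ∧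
    p.fst =ᵐ[volume] φ ∧ p.snd =ᵐ[volume] fracGrad s φ}

/-- `H^s_0(Ω)`: the closure of `C_c^∞(Ω)` in the graph norm `(‖u‖² + ‖D^s u‖²)^{1/2}`, as a Hilbert
space of pairs `(u, D^s u)` of functions on the whole space. The set `testPairs s Ω` is already a
linear subspace, so taking its span does not enlarge it. -/
def Hs0 {d : ℕ} (s : ℝ) (Ω : Set (Rd d)) : Submodule ℝ (Pairs d) :=
  (Submodule.span ℝ (testPairs s Ω)).topologicalClosure

/-- `H^s(ℝ^d)`, in which `C_c^∞(ℝ^d)` is dense. -/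
abbrev Hs (d : ℕ) (s : ℝ) : Submodule ℝ (Pairs d) := Hs0 s (univ : Set (Rd d))

/-- `H^{-s}(Ω)`, the dual of `H^s_0(Ω)`, as a topological vector space. The norm used in the
estimates is `dualNorm`. -/
abbrev HNeg {d : ℕ} (s : ℝ) (Ω : Set (Rd d)) : Type := StrongDual ℝ (Hs0 s Ω)

/-- Restriction to `Ω` of the function component of a pair. -/
def restr {d : ℕ} (Ω : Set (Rd d)) : Pairs d →L[ℝ] L2 Ω :=
  (LpToLpRestrictCLM (Rd d) ℝ ℝ volume 2 Ω).comp (WithLp.fstL 2 ℝ _ _)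

/-- The embedding `L²(Ω) → H^{-s}(Ω)`, `h ↦ (v ↦ ∫_Ω h v)`. -/
def embed {d : ℕ} (s : ℝ) (Ω : Set (Rd d)) (h : L2 Ω) : HNeg s Ω :=
  (innerSL ℝ h).comp ((restr Ω).comp (Hs0 s Ω).subtypeL)

/-- The matrix field `A` is measurable, symmetric, and
`a |z|² ≤ A(x) z · z ≤ b |z|²` for a.e. `x` and all `z`. -/
structure IsElliptic {d : ℕ} (A : Rd d → Matrix (Fin d) (Fin d) ℝ) (a b : ℝ) : Prop where
  measurable : ∀ i j, Measurable fun x => A x i j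
  symm : ∀ᵐ x, (A x).IsSymm
  pos : 0 < a
  bounds : ∀ᵐ x, ∀ z : Rd d,
    a * ‖z‖ ^ 2 ≤ inner ℝ (Matrix.toEuclideanLin (A x) z) z ∧
      inner ℝ (Matrix.toEuclideanLin (A x) z) z ≤ b * ‖z‖ ^ 2

/-- `[u, v]_A = ∫_{ℝ^d} A D^s u · D^s v = ⟨𝓛_A^s u, v⟩`. -/
def energy {d : ℕ} (A : Rd d → Matrix (Fin d) (Fin d) ℝ) (u v : Pairs d) : ℝ :=
  ∫ x, inner ℝ (Matrix.toEuclideanLin (A x) (u.snd x)) (v.snd x)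

/-- The norm of `H^{-s}(Ω)` as the dual of `H^s_0(Ω)` equipped with the inner product `[·,·]_A`.
By Riesz representation `dualNorm A (𝓛_A^s u) = [u, u]_A^{1/2}` for `u ∈ H^s_0(Ω)`. It is finite for
bounded `Ω` by the fractional Poincaré inequality; as an extended real it has no junk values. -/
def dualNorm {d : ℕ} {s : ℝ} {Ω : Set (Rd d)} (A : Rd d → Matrix (Fin d) (Fin d) ℝ)
    (F : HNeg s Ω) : ℝ≥0∞ :=
  ⨆ (v : Hs0 s Ω) (_ : energy A v v ≤ 1), ‖F v‖ₑ

/-- Lebesgue measure on the time interval `]0,T[`. -/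
abbrev timeMeasure (T : ℝ) : Measure ℝ := volume.restrict (Ioo 0 T)

/-- The assumptions on the two-phase law `γ` (with Lipschitz constant `C`): the inverse of a maximal
monotone graph, hence nondecreasing, Lipschitz, `γ(0) = 0` and `liminf_{|r| → ∞} γ(r)/r > 0`. -/
structure IsTwoPhaseLaw (γ : ℝ → ℝ) (C : ℝ≥0) : Prop where
  mono : Monotone γ
  lipschitz : LipschitzWith C γ
  map_zero : γ 0 = 0
  growth : 0 < Filter.liminf (fun r => γ r / r) (Bornology.cobounded ℝ)

/-- The temperature `ϑ = γ(η)` at a fixed time. -/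
def temperature {d : ℕ} {Ω : Set (Rd d)} {γ : ℝ → ℝ} {C : ℝ≥0} (hγ : IsTwoPhaseLaw γ C)
    (η : L2 Ω) : L2 Ω :=
  hγ.lipschitz.compLp hγ.map_zero η

/-- `g'` belongs to `BV(0,T; L²(Ω)) ∩ L²(0,T; H^s(ℝ^d))`, and, for a.e. `t`, `g(t)` is the
`𝓛_A^s`-harmonic function in `Ω` with `g(t) = g'(t)` a.e. outside `Ω`. -/
structure IsDirichletDatum {d : ℕ} (s T : ℝ) (Ω : Set (Rd d))
    (A : Rd d → Matrix (Fin d) (Fin d) ℝ) (g' g : ℝ → Pairs d) : Prop where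
  memLp : MemLp g' 2 (timeMeasure T)
  mem_Hs : ∀ᵐ t ∂timeMeasure T, g' t ∈ Hs d s
  bv : ∃ h : ℝ → L2 Ω, BoundedVariationOn h (Icc 0 T) ∧
    ∀ᵐ t ∂timeMeasure T, h t = restr Ω (g' t)
  ext_mem_Hs : ∀ᵐ t ∂timeMeasure T, g t ∈ Hs d s
  ext_eq : ∀ᵐ t ∂timeMeasure T, (g t).fst =ᵐ[volume.restrict Ωᶜ] (g' t).fst
  harmonic : ∀ᵐ t ∂timeMeasure T, ∀ v ∈ Hs0 s Ω, energy A (g t) v = 0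

/-- `η` is a generalised enthalpy solution with data `(f, g, η₀)`:
`η ∈ L²(0,T; L²(Ω)) ∩ H¹(0,T; H^{-s}(Ω))`, `w = γ(η) - g ∈ L²(0,T; H^s_0(Ω))`, `η(0) = η₀` and
`⟨dη/dt, ξ⟩ + ⟨𝓛_A^s (γ(η) - g), ξ⟩ = ⟨f, ξ⟩` for all `ξ ∈ L²(0,T; H^s_0(Ω))`.
The curve `ηc : [0,T] → H^{-s}(Ω)` is the (absolutely) continuous representative of `η`, whose
values are the meaning of `η(t)` for every `t ∈ [0,T]`. -/
structure IsEnthalpySolution {d : ℕ} (s T : ℝ) (Ω : Set (Rd d))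
    (A : Rd d → Matrix (Fin d) (Fin d) ℝ) {γ : ℝ → ℝ} {C : ℝ≥0} (hγ : IsTwoPhaseLaw γ C)
    (f : ℝ → HNeg s Ω) (g : ℝ → Pairs d) (η₀ : L2 Ω)
    (η : ℝ → L2 Ω) (ηc : ℝ → HNeg s Ω) : Prop where
  memLp : MemLp η 2 (timeMeasure T)
  rep : ∀ᵐ t ∂timeMeasure T, ηc t = embed s Ω (η t)
  initial : ηc 0 = embed s Ω η₀
  eqn : ∃ (dη : ℝ → HNeg s Ω) (w : ℝ → Hs0 s Ω),
    MemLp dη 2 (timeMeasure T) ∧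
    (∀ t ∈ Icc 0 T, ηc t = ηc 0 + ∫ τ in (0 : ℝ)..t, dη τ) ∧
    MemLp w 2 (timeMeasure T) ∧
    (∀ᵐ t ∂timeMeasure T, restr Ω (w t) = temperature hγ (η t) - restr Ω (g t)) ∧
    ∀ ξ : ℝ → Hs0 s Ω, MemLp ξ 2 (timeMeasure T) →
      (∫ t, dη t (ξ t) ∂timeMeasure T) + (∫ t, energy A (w t) (ξ t) ∂timeMeasure T)
        = ∫ t, f t (ξ t) ∂timeMeasure T

end FracStefan

end

/-! ### Absolute continuity, the chain rule and Grönwall's inequality. -/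

section Calculus

/-! Let `E` be the difference of the enthalpies and `v` that of the temperatures. The datum `g`
cancels, so `v` takes values in `Hs0 s Ω` and `dE/dt + 𝓛 v = F` with `F = f - f₁`. Testing with `𝓛⁻¹
E` gives, in the dual norm, `½ d/dt ‖E‖² + ⟨E, v⟩ = ⟨F, 𝓛⁻¹ E⟩ ≤ ‖F‖ ‖E‖`. Monotonicity of `γ` makes
`⟨E, v⟩ ≥ 0`, and a quadratic Grönwall lemma (`le_add_integral_of_sq_le`) yields the first estimate.
Keeping `⟨E, v⟩` bounds its time integral, and cocoercivity, `‖v‖² ≤ C ⟨E, v⟩` in `L²(Ω)`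
(`norm_temperature_sub_sq_le`), turns this into the second.

To avoid inverting `𝓛`, the test function is `J E`, where `J` inverts the form plus `ε` times the
inner product. This costs an error `√ε ‖v‖` in the source (`energy_le`). The regularised norm `√(F
(J F))` is at most the dual norm for every `ε > 0` (`ofReal_sqrt_le`), while `abs_apply_le` recovers
the dual norm as `ε → 0`. -/

theorem AbsolutelyContinuousOnInterval.of_dist_le {X Y : Type*} [PseudoMetricSpace X]
    [PseudoMetricSpace Y] {f : ℝ → X} {g : ℝ → Y} {a b c : ℝ}
    (hg : AbsolutelyContinuousOnInterval g a b)
    (h : ∀ x ∈ uIcc a b, ∀ y ∈ uIcc a b, dist (f x) (f y) ≤ c * dist (g x) (g y)) :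
    AbsolutelyContinuousOnInterval f a b := by
  unfold AbsolutelyContinuousOnInterval at hg ⊢
  refine squeeze_zero' (.of_forall fun _ => Finset.sum_nonneg fun _ _ => dist_nonneg) ?_
    (by simpa using hg.const_mul c)
  rw [Filter.eventually_inf_principal]
  filter_upwards with E hE
  rw [Finset.mul_sum]
  exact Finset.sum_le_sum fun i hi => h _ (hE.1 i hi).1 _ (hE.1 i hi).2

/-- The chain rule, in integrated form, for a continuous quadratic form along a primitive. -/
theorem quadratic_primitive_eq {X : Type*} [NormedAddCommGroup X] [NormedSpace ℝ X]
    [CompleteSpace X] (B : X →L[ℝ] X →L[ℝ] ℝ) (hB : ∀ x y, B x y = B y x) {u : ℝ → X} {t : ℝ}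
    (hu : IntervalIntegrable u volume 0 t) (U₀ : X) :
    B (U₀ + ∫ τ in (0 : ℝ)..t, u τ) (U₀ + ∫ τ in (0 : ℝ)..t, u τ) =
      B U₀ U₀ + 2 * ∫ τ in (0 : ℝ)..t, B (u τ) (U₀ + ∫ σ in (0 : ℝ)..τ, u σ) := by
  set U : ℝ → X := fun τ => U₀ + ∫ σ in (0 : ℝ)..τ, u σ with hU
  have hUc : ContinuousOn U (uIcc 0 t) :=
    continuousOn_const.add
      (intervalIntegral.continuousOn_primitive_interval' hu left_mem_uIcc)
  obtain ⟨M, hM⟩ := isCompact_uIcc.exists_bound_of_continuousOn hUc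
  have hint : ∀ x ∈ uIcc 0 t, IntervalIntegrable u volume 0 x := fun x hx =>
    hu.mono_set (uIcc_subset_uIcc left_mem_uIcc hx)
  -- `U` is differentiable only almost everywhere, so integrating the derivative back requires
  -- absolute continuity. It is inherited from the scalar primitive of `‖u‖`, which dominates the
  -- increments of `U`.
  have hac : AbsolutelyContinuousOnInterval (fun τ => B (U τ) (U τ)) 0 t := by
    refine (hu.norm.absolutelyContinuousOnInterval_intervalIntegral
      left_mem_uIcc).of_dist_le (c := 2 * ‖B‖ * M) fun x hx y hy => ?_
    have hsub : ‖U x - U y‖ ≤ dist (∫ σ in (0 : ℝ)..x, ‖u σ‖) (∫ σ in (0 : ℝ)..y, ‖u σ‖) := by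
      rw [Real.dist_eq, intervalIntegral.integral_interval_sub_left (hint x hx).norm
        (hint y hy).norm]
      simp only [hU, add_sub_add_left_eq_sub]
      rw [intervalIntegral.integral_interval_sub_left (hint x hx) (hint y hy)]
      exact intervalIntegral.norm_integral_le_abs_integral_norm
    have hsplit : B (U x) (U x) - B (U y) (U y) = B (U x - U y) (U x) + B (U x - U y) (U y) := by
      rw [hB (U x - U y) (U y)]
      simp only [map_sub, sub_apply]
      rw [hB (U y) (U x)]
      ring
    rw [Real.dist_eq, hsplit]
    have h1 := B.le_opNorm₂ (U x - U y) (U x)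
    have h2 := B.le_opNorm₂ (U x - U y) (U y)
    rw [Real.norm_eq_abs] at h1 h2
    have hM0 : 0 ≤ M := (norm_nonneg _).trans (hM x hx)
    calc |B (U x - U y) (U x) + B (U x - U y) (U y)|
        ≤ ‖B‖ * ‖U x - U y‖ * ‖U x‖ + ‖B‖ * ‖U x - U y‖ * ‖U y‖ :=
          (abs_add_le _ _).trans (add_le_add h1 h2)
      _ ≤ ‖B‖ * ‖U x - U y‖ * M + ‖B‖ * ‖U x - U y‖ * M := by
          gcongr
          · exact hM x hx
          · exact hM y hy
      _ = 2 * ‖B‖ * M * ‖U x - U y‖ := by ring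
      _ ≤ _ := by gcongr
  have hderiv : ∫ τ in (0 : ℝ)..t, deriv (fun τ => B (U τ) (U τ)) τ =
      ∫ τ in (0 : ℝ)..t, 2 * B (u τ) (U τ) := by
    refine intervalIntegral.integral_congr_ae ?_
    filter_upwards [hu.ae_hasDerivAt_integral] with τ hτ hτm
    have hUd : HasDerivAt U (u τ) τ :=
      (hτ (uIoc_subset_uIcc hτm) 0 left_mem_uIcc).const_add U₀
    have hBU : HasDerivAt (fun τ => B (U τ)) (B (u τ)) τ := B.hasFDerivAt.comp_hasDerivAt τ hUd
    rw [(hBU.clm_apply hUd).deriv, hB (U τ) (u τ)]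
    ring
  have := hac.integral_deriv_eq_sub
  rw [hderiv, intervalIntegral.integral_const_mul] at this
  have h0 : U 0 = U₀ := by simp [hU]
  rw [h0] at this
  linarith

/-- Grönwall's lemma for a quadratic integral inequality. -/
theorem le_add_integral_of_sq_le {y k : ℝ → ℝ} {y₀ T : ℝ} (hy : ContinuousOn y (Icc 0 T))
    (hk : IntervalIntegrable k volume 0 T) (hk0 : ∀ t, 0 ≤ k t) (hy₀ : 0 ≤ y₀)
    (h : ∀ t ∈ Icc 0 T, y t ^ 2 ≤ y₀ ^ 2 + 2 * ∫ τ in (0 : ℝ)..t, k τ * y τ)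
    {t : ℝ} (ht : t ∈ Icc 0 T) : y t ≤ y₀ + ∫ τ in (0 : ℝ)..t, k τ := by
  have hT : 0 ≤ T := ht.1.trans ht.2
  have hK : ContinuousOn (fun t => ∫ τ in (0 : ℝ)..t, k τ) (Icc 0 T) := by
    have := intervalIntegral.continuousOn_primitive_interval' hk left_mem_uIcc
    rwa [uIcc_of_le hT] at this
  have hKnonneg : ∀ t ∈ Icc 0 T, 0 ≤ ∫ τ in (0 : ℝ)..t, k τ := fun t ht =>
    intervalIntegral.integral_nonneg ht.1 fun τ _ => hk0 τ
  refine le_of_forall_pos_lt_add fun δ hδ => ?_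
  by_contra! hcon
  -- `r` is the first time `y` reaches the barrier `P = y₀ + δ + ∫ k`. Before `r` one has `y < P`,
  -- and `P² = (y₀ + δ)² + 2 ∫ k P`; hence `y(r)² ≤ y₀² + P(r)² - (y₀ + δ)² < P(r)²`, a
  -- contradiction.
  set S := {t ∈ Icc 0 T | y₀ + δ + (∫ τ in (0 : ℝ)..t, k τ) ≤ y t} with hS
  have hSc : IsCompact S :=
    isCompact_Icc.of_isClosed_subset
      (isClosed_Icc.isClosed_le (continuousOn_const.add hK) hy) fun _ hx => hx.1
  obtain ⟨r, hr, hrmin⟩ := hSc.exists_isLeast ⟨t, ht, by linarith⟩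
  have hkr : IntervalIntegrable k volume 0 r :=
    hk.mono_set (uIcc_subset_uIcc left_mem_uIcc (by rw [uIcc_of_le hT]; exact hr.1))
  have hsub : Icc 0 r ⊆ Icc 0 T := Icc_subset_Icc_right hr.1.2
  have hsq := quadratic_primitive_eq (ContinuousLinearMap.mul ℝ ℝ) (fun x y => mul_comm x y)
    hkr (y₀ + δ)
  simp only [ContinuousLinearMap.mul_apply'] at hsq
  have hle : ∫ τ in (0 : ℝ)..r, k τ * y τ ≤
      ∫ τ in (0 : ℝ)..r, k τ * (y₀ + δ + ∫ σ in (0 : ℝ)..τ, k σ) := by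
    refine intervalIntegral.integral_mono_on_of_le_Ioo hr.1.1 ?_ ?_ fun τ hτ => ?_
    · exact hkr.mul_continuousOn (by rw [uIcc_of_le hr.1.1]; exact hy.mono hsub)
    · exact hkr.mul_continuousOn
        (by rw [uIcc_of_le hr.1.1]; exact (continuousOn_const.add hK).mono hsub)
    · refine mul_le_mul_of_nonneg_left ?_ (hk0 τ)
      by_contra! hlt
      exact absurd (hrmin ⟨hsub (Ioo_subset_Icc_self hτ), hlt.le⟩) (not_le.mpr hτ.2)
  have h1 := h r hr.1
  have h2 := hKnonneg r hr.1
  have h3 := hr.2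
  nlinarith

end Calculus

/-! The energy form is regularised by `ε` times the inner product of `H`. The estimates are uniform
in `ε`, and the limit `ε → 0` recovers the norm dual to `B`, so no coercivity of `B` (no Poincaré
inequality) enters. -/

/-! ### The regularised Riesz map and its dual norm. -/

section Regularization

variable {H : Type*} [NormedAddCommGroup H] [InnerProductSpace ℝ H]

/-- The norm on the dual of `H` which is dual to the seminorm `v ↦ (B v v)^{1/2}`. -/
noncomputable def formDualNorm (B : H →L[ℝ] H →L[ℝ] ℝ) (F : StrongDual ℝ H) : ℝ≥0∞ :=
  ⨆ (v : H) (_ : B v v ≤ 1), ‖F v‖ₑ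

/-- The form `B + ε ⟪·,·⟫`. -/
noncomputable def regularizedForm (B : H →L[ℝ] H →L[ℝ] ℝ) (ε : ℝ) : H →L[ℝ] H →L[ℝ] ℝ :=
  let I : H →L[ℝ] H →L[ℝ] ℝ := innerSL ℝ
  B + ε • I

theorem regularizedForm_apply (B : H →L[ℝ] H →L[ℝ] ℝ) (ε : ℝ) (u v : H) :
    regularizedForm B ε u v = B u v + ε * inner ℝ u v := rfl

/-- `J` is the Riesz map of the inner product `B + ε ⟪·,·⟫`. -/
def IsRegularizedRiesz (B : H →L[ℝ] H →L[ℝ] ℝ) (ε : ℝ) (J : StrongDual ℝ H →L[ℝ] H) : Prop :=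
  ∀ F v, B (J F) v + ε * inner ℝ (J F) v = F v

/-- Lax–Milgram: since `B` is nonnegative, the added term makes the form coercive with constant `ε`.
-/
theorem exists_isRegularizedRiesz [CompleteSpace H] {B : H →L[ℝ] H →L[ℝ] ℝ}
    (hB0 : ∀ v, 0 ≤ B v v) {ε : ℝ} (hε : 0 < ε) : ∃ J, IsRegularizedRiesz B ε J := by
  have hc : IsCoercive (regularizedForm B ε) := by
    refine ⟨ε, hε, fun u => ?_⟩
    have := hB0 u
    rw [regularizedForm_apply, real_inner_self_eq_norm_sq]
    nlinarith
  let R : StrongDual ℝ H →L[ℝ] H :=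
    (InnerProductSpace.toDual ℝ H).symm.toContinuousLinearEquiv.toContinuousLinearMap
  refine ⟨(hc.continuousLinearEquivOfBilin.symm : H →L[ℝ] H).comp R, fun F v => ?_⟩
  have := hc.continuousLinearEquivOfBilin_apply
    (hc.continuousLinearEquivOfBilin.symm ((InnerProductSpace.toDual ℝ H).symm F)) v
  rw [ContinuousLinearEquiv.apply_symm_apply, InnerProductSpace.toDual_symm_apply] at this
  exact this.symm

namespace IsRegularizedRiesz

variable {B : H →L[ℝ] H →L[ℝ] ℝ} {ε : ℝ} {J : StrongDual ℝ H →L[ℝ] H}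

theorem apply_comm (hJ : IsRegularizedRiesz B ε J) (hB : ∀ u v, B u v = B v u)
    (F G : StrongDual ℝ H) : F (J G) = G (J F) := by
  rw [← hJ F, ← hJ G, hB, real_inner_comm]

theorem apply_self_eq (hJ : IsRegularizedRiesz B ε J) (F : StrongDual ℝ H) :
    F (J F) = B (J F) (J F) + ε * ‖J F‖ ^ 2 := by
  rw [← hJ F (J F), real_inner_self_eq_norm_sq]

theorem apply_self_nonneg (hJ : IsRegularizedRiesz B ε J) (hB0 : ∀ v, 0 ≤ B v v) (hε : 0 < ε)
    (F : StrongDual ℝ H) : 0 ≤ F (J F) := by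
  rw [hJ.apply_self_eq]
  have := hB0 (J F)
  positivity

/-- Cauchy–Schwarz for the regularised form, applied to `J F` and `v`. -/
theorem abs_apply_le (hJ : IsRegularizedRiesz B ε J) (hB : ∀ u v, B u v = B v u)
    (hB0 : ∀ v, 0 ≤ B v v) (hε : 0 < ε) (F : StrongDual ℝ H) (v : H) :
    |F v| ≤ √(F (J F)) * √(B v v + ε * ‖v‖ ^ 2) := by
  let b : LinearMap.BilinForm ℝ H := (regularizedForm B ε).toBilinForm
  have hb : ∀ u v, b u v = B u v + ε * inner ℝ u v := fun u v => rfl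
  have hb0 : ∀ u, 0 ≤ b u u := fun u => by
    rw [hb, real_inner_self_eq_norm_sq]
    have := hB0 u
    positivity
  have hcs := b.apply_sq_le_of_symm hb0
    ⟨fun u v => by simp [hb, hB u v, real_inner_comm]⟩ (J F) v
  rw [hb, hb, hb, hJ F v, hJ F (J F), real_inner_self_eq_norm_sq] at hcs
  rw [← Real.sqrt_mul (hJ.apply_self_nonneg hB0 hε F), ← Real.sqrt_sq_eq_abs]
  exact Real.sqrt_le_sqrt hcs

/-- Follows from `ε ‖J F‖² ≤ F (J F)`. The factor `√ε` is what makes the regularisation error vanish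
in the limit. -/
theorem norm_le (hJ : IsRegularizedRiesz B ε J) (hB0 : ∀ v, 0 ≤ B v v) (hε : 0 < ε)
    (F : StrongDual ℝ H) : ε * ‖J F‖ ≤ √ε * √(F (J F)) := by
  have h1 : √ε * ‖J F‖ ≤ √(F (J F)) := by
    refine Real.le_sqrt_of_sq_le ?_
    rw [mul_pow, Real.sq_sqrt hε.le, hJ.apply_self_eq]
    linarith [hB0 (J F)]
  calc ε * ‖J F‖ = √ε * (√ε * ‖J F‖) := by rw [← mul_assoc, Real.mul_self_sqrt hε.le]
    _ ≤ _ := by gcongr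

/-- The vector `J F / √(F (J F))` is admissible in the supremum because `B (J F) (J F) ≤ F (J F)`,
and `F` takes the value `√(F (J F))` there. -/
theorem ofReal_sqrt_le (hJ : IsRegularizedRiesz B ε J) (hB0 : ∀ v, 0 ≤ B v v) (hε : 0 < ε)
    (F : StrongDual ℝ H) : ENNReal.ofReal √(F (J F)) ≤ formDualNorm B F := by
  have hq := hJ.apply_self_nonneg hB0 hε F
  rcases hq.eq_or_lt with hq0 | hq0
  · simp [← hq0]
  have hs : 0 < √(F (J F)) := Real.sqrt_pos.mpr hq0
  refine le_trans (le_of_eq ?_) (le_iSup₂ (f := fun (v : H) (_ : B v v ≤ 1) => ‖F v‖ₑ)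
    ((√(F (J F)))⁻¹ • J F) ?_)
  · rw [map_smul, smul_eq_mul, Real.enorm_eq_ofReal (by positivity)]
    congr 1
    nth_rw 3 [← Real.mul_self_sqrt hq]
    field_simp
  · simp only [map_smul, smul_apply, smul_eq_mul]
    rw [← mul_assoc, ← mul_inv, Real.mul_self_sqrt hq, inv_mul_le_one₀ hq0, hJ.apply_self_eq]
    have : 0 ≤ ε * ‖J F‖ ^ 2 := by positivity
    linarith

end IsRegularizedRiesz

end Regularization

/-! ### Energy estimates for evolutions in the dual space. -/

section DualEvolution

variable {H : Type*} [NormedAddCommGroup H] [InnerProductSpace ℝ H]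

/-- The curve `E(t) = E₀ + ∫₀ᵗ dE` in the dual of `H` solves `dE/dt + B v = F` weakly on `(0,T)`,
and `⟨E(t), v(t)⟩ ≥ 0` for a.e. `t`. -/
structure IsDualEvolution (B : H →L[ℝ] H →L[ℝ] ℝ) (T : ℝ) (E₀ : StrongDual ℝ H)
    (dE F : ℝ → StrongDual ℝ H) (v : ℝ → H) : Prop where
  memLp_deriv : MemLp dE 2 (volume.restrict (Ioo 0 T))
  memLp_source : MemLp F 2 (volume.restrict (Ioo 0 T))
  memLp_flux : MemLp v 2 (volume.restrict (Ioo 0 T))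
  eqn : ∀ ξ : ℝ → H, MemLp ξ 2 (volume.restrict (Ioo 0 T)) →
    (∫ t in Ioo 0 T, dE t (ξ t)) + (∫ t in Ioo 0 T, B (v t) (ξ t)) = ∫ t in Ioo 0 T, F t (ξ t)
  nonneg : ∀ᵐ t ∂volume.restrict (Ioo 0 T), 0 ≤ (E₀ + ∫ τ in (0 : ℝ)..t, dE τ) (v t)

/-- Localises the weak equation on `(0,T)` to `(0,t)` by cutting off the test function. -/
theorem setIntegral_Ioo_indicator {X : Type*} {T t : ℝ} (ht : t ∈ Icc 0 T) [Zero X]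
    (φ : ℝ → X → ℝ) (hφ : ∀ τ, φ τ 0 = 0) (g : ℝ → X) :
    ∫ τ in Ioo 0 T, φ τ ((Ioo 0 t).indicator g τ) = ∫ τ in Ioo 0 t, φ τ (g τ) := by
  have : (fun τ => φ τ ((Ioo 0 t).indicator g τ)) = (Ioo 0 t).indicator fun τ => φ τ (g τ) := by
    ext τ
    by_cases h : τ ∈ Ioo 0 t <;> simp [h, hφ]
  rw [this, setIntegral_indicator measurableSet_Ioo,
    inter_eq_self_of_subset_right (Ioo_subset_Ioo_right ht.2)]

theorem MeasureTheory.MemLp.intervalIntegrable_of_mem_Icc {X : Type*} [NormedAddCommGroup X]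
    {u : ℝ → X} {T t : ℝ} (hu : MemLp u 2 (volume.restrict (Ioo 0 T))) (ht : t ∈ Icc 0 T) :
    IntervalIntegrable u volume 0 t := by
  rw [intervalIntegrable_iff_integrableOn_Ioo_of_le ht.1]
  exact IntegrableOn.mono_set (hu.integrable one_le_two) (Ioo_subset_Ioo_right ht.2)

theorem primitive_sub_primitive {X : Type*} [NormedAddCommGroup X] [NormedSpace ℝ X]
    {p p₁ u u₁ : ℝ → X} {T : ℝ} (hu : MemLp u 2 (volume.restrict (Ioo 0 T)))
    (hu₁ : MemLp u₁ 2 (volume.restrict (Ioo 0 T)))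
    (hp : ∀ t ∈ Icc 0 T, p t = p 0 + ∫ τ in (0 : ℝ)..t, u τ)
    (hp₁ : ∀ t ∈ Icc 0 T, p₁ t = p₁ 0 + ∫ τ in (0 : ℝ)..t, u₁ τ) :
    ∀ t ∈ Icc 0 T, p t - p₁ t = p 0 - p₁ 0 + ∫ τ in (0 : ℝ)..t, (u τ - u₁ τ) := fun t ht => by
  rw [intervalIntegral.integral_sub (hu.intervalIntegrable_of_mem_Icc ht)
    (hu₁.intervalIntegrable_of_mem_Icc ht), hp t ht, hp₁ t ht]
  abel

theorem MeasureTheory.MemLp.integrable_clm_apply {α X : Type*} [MeasurableSpace α] {μ : Measure α}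
    [NormedAddCommGroup X] [NormedSpace ℝ X] {f : α → StrongDual ℝ X} {g : α → X}
    (hf : MemLp f 2 μ) (hg : MemLp g 2 μ) : Integrable (fun x => f x (g x)) μ :=
  memLp_one_iff_integrable.mp
    ((ContinuousLinearMap.id ℝ (StrongDual ℝ X)).memLp_of_bilin 1 hf hg)

theorem MeasureTheory.MemLp.integrable_bilin {α X Y : Type*} [MeasurableSpace α] {μ : Measure α}
    [NormedAddCommGroup X] [NormedSpace ℝ X] [NormedAddCommGroup Y] [NormedSpace ℝ Y]
    (B : X →L[ℝ] Y →L[ℝ] ℝ) {f : α → X} {g : α → Y}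
    (hf : MemLp f 2 μ) (hg : MemLp g 2 μ) : Integrable (fun x => B (f x) (g x)) μ :=
  memLp_one_iff_integrable.mp (B.memLp_of_bilin 1 hf hg)

theorem MeasureTheory.MemLp.sqrt_apply_self {α : Type*} [MeasurableSpace α] {μ : Measure α}
    (J : StrongDual ℝ H →L[ℝ] H) {F : α → StrongDual ℝ H} (hF : MemLp F 2 μ) :
    MemLp (fun x => √(F x (J (F x)))) 2 μ := by
  refine hF.of_le_mul (c := √‖J‖) ?_ (.of_forall fun x => ?_)
  · exact Real.continuous_sqrt.comp_aestronglyMeasurable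
      (hF.integrable_clm_apply (J.comp_memLp' hF)).aestronglyMeasurable
  · rw [Real.norm_of_nonneg (Real.sqrt_nonneg _)]
    refine Real.sqrt_le_iff.mpr ⟨by positivity, ?_⟩
    rw [mul_pow, Real.sq_sqrt (norm_nonneg J)]
    calc F x (J (F x)) ≤ ‖F x (J (F x))‖ := Real.le_norm_self _
      _ ≤ ‖F x‖ * (‖J‖ * ‖F x‖) := (F x).le_opNorm_of_le (J.le_opNorm _)
      _ = _ := by ring

namespace IsDualEvolution

variable {B : H →L[ℝ] H →L[ℝ] ℝ} {T : ℝ} {E₀ : StrongDual ℝ H} {dE F : ℝ → StrongDual ℝ H}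
  {v : ℝ → H}

/-- The difference of two weak solutions of `dp/dt + B w = F`. -/
theorem of_sub {dp dp₁ F₁ : ℝ → StrongDual ℝ H} {w w₁ : ℝ → H}
    (hdp : MemLp dp 2 (volume.restrict (Ioo 0 T))) (hdp₁ : MemLp dp₁ 2 (volume.restrict (Ioo 0 T)))
    (hF : MemLp F 2 (volume.restrict (Ioo 0 T))) (hF₁ : MemLp F₁ 2 (volume.restrict (Ioo 0 T)))
    (hw : MemLp w 2 (volume.restrict (Ioo 0 T))) (hw₁ : MemLp w₁ 2 (volume.restrict (Ioo 0 T)))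
    (heq : ∀ ξ : ℝ → H, MemLp ξ 2 (volume.restrict (Ioo 0 T)) →
      (∫ t in Ioo 0 T, dp t (ξ t)) + (∫ t in Ioo 0 T, B (w t) (ξ t)) = ∫ t in Ioo 0 T, F t (ξ t))
    (heq₁ : ∀ ξ : ℝ → H, MemLp ξ 2 (volume.restrict (Ioo 0 T)) →
      (∫ t in Ioo 0 T, dp₁ t (ξ t)) + (∫ t in Ioo 0 T, B (w₁ t) (ξ t)) =
        ∫ t in Ioo 0 T, F₁ t (ξ t))
    (hnonneg : ∀ᵐ t ∂volume.restrict (Ioo 0 T),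
      0 ≤ (E₀ + ∫ τ in (0 : ℝ)..t, (dp τ - dp₁ τ)) (w t - w₁ t)) :
    IsDualEvolution B T E₀ (fun t => dp t - dp₁ t) (fun t => F t - F₁ t) fun t => w t - w₁ t := by
  refine ⟨hdp.sub hdp₁, hF.sub hF₁, hw.sub hw₁, fun ξ hξ => ?_, hnonneg⟩
  simp only [sub_apply, map_sub]
  rw [integral_sub (hdp.integrable_clm_apply hξ) (hdp₁.integrable_clm_apply hξ),
    integral_sub (hF.integrable_clm_apply hξ) (hF₁.integrable_clm_apply hξ),
    integral_sub (hw.integrable_bilin B hξ) (hw₁.integrable_bilin B hξ)]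
  linarith [heq ξ hξ, heq₁ ξ hξ]

theorem intervalIntegrable_deriv (h : IsDualEvolution B T E₀ dE F v) (hT : 0 ≤ T) :
    IntervalIntegrable dE volume 0 T :=
  h.memLp_deriv.intervalIntegrable_of_mem_Icc ⟨hT, le_rfl⟩

theorem continuousOn (h : IsDualEvolution B T E₀ dE F v) (hT : 0 ≤ T) :
    ContinuousOn (fun t => E₀ + ∫ τ in (0 : ℝ)..t, dE τ) (Icc 0 T) := by
  have := intervalIntegral.continuousOn_primitive_interval' (h.intervalIntegrable_deriv hT)
    left_mem_uIcc
  rw [uIcc_of_le hT] at this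
  exact continuousOn_const.add this

theorem memLp (h : IsDualEvolution B T E₀ dE F v) (hT : 0 ≤ T) :
    MemLp (fun t => E₀ + ∫ τ in (0 : ℝ)..t, dE τ) 2 (volume.restrict (Ioo 0 T)) := by
  obtain ⟨M, hM⟩ := isCompact_Icc.exists_bound_of_continuousOn (h.continuousOn hT)
  refine MemLp.of_bound
    (((h.continuousOn hT).mono Ioo_subset_Icc_self).aestronglyMeasurable measurableSet_Ioo) M ?_
  filter_upwards [ae_restrict_mem measurableSet_Ioo] with t ht
  exact hM t (Ioo_subset_Icc_self ht)

/-- The energy inequality in the regularised dual norm. -/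
theorem energy_le (h : IsDualEvolution B T E₀ dE F v) (hB : ∀ u w, B u w = B w u)
    (hB0 : ∀ w, 0 ≤ B w w) {ε : ℝ} (hε : 0 < ε) {J : StrongDual ℝ H →L[ℝ] H}
    (hJ : IsRegularizedRiesz B ε J) {E : ℝ → StrongDual ℝ H}
    (hE : E = fun t => E₀ + ∫ τ in (0 : ℝ)..t, dE τ) {t : ℝ} (ht : t ∈ Icc 0 T) :
    E t (J (E t)) + 2 * (∫ τ in Ioo 0 t, E τ (v τ)) ≤ E₀ (J E₀) + 2 * ∫ τ in (0 : ℝ)..t,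
      (√(F τ (J (F τ))) + √ε * ‖v τ‖) * √(E τ (J (E τ))) := by
  have hT : 0 ≤ T := ht.1.trans ht.2
  have hμ : volume.restrict (Ioo 0 t) ≤ volume.restrict (Ioo 0 T) :=
    Measure.restrict_mono (Ioo_subset_Ioo_right ht.2) le_rfl
  have hEL : MemLp E 2 (volume.restrict (Ioo 0 T)) := hE ▸ h.memLp hT
  have hJEL := J.comp_memLp' hEL
  -- The test function is the regularised `𝓛⁻¹ E`, cut off at time `t`.
  have hweak := h.eqn ((Ioo 0 t).indicator fun τ => J (E τ)) (hJEL.indicator measurableSet_Ioo)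
  rw [setIntegral_Ioo_indicator ht (fun τ x => dE τ x) (by simp),
    setIntegral_Ioo_indicator ht (fun τ x => B (v τ) x) (by simp),
    setIntegral_Ioo_indicator ht (fun τ x => F τ x) (by simp)] at hweak
  have hquad := quadratic_primitive_eq (X := StrongDual ℝ H)
    ((ContinuousLinearMap.id ℝ (StrongDual ℝ H)).bilinearComp (.id ℝ _) J)
    (fun F G => hJ.apply_comm hB F G)
    (h.memLp_deriv.intervalIntegrable_of_mem_Icc ht) E₀
  have hquad' : E t (J (E t)) = E₀ (J E₀) + 2 * ∫ τ in Ioo 0 t, dE τ (J (E τ)) := by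
    rw [← integral_Ioc_eq_integral_Ioo, ← intervalIntegral.integral_of_le ht.1, hE]
    exact hquad
  have hFi : Integrable (fun τ => F τ (J (E τ))) (volume.restrict (Ioo 0 t)) :=
    (h.memLp_source.integrable_clm_apply hJEL).mono_measure hμ
  have hBi : Integrable (fun τ => B (v τ) (J (E τ))) (volume.restrict (Ioo 0 t)) :=
    (h.memLp_flux.integrable_bilin B hJEL).mono_measure hμ
  have hEi : Integrable (fun τ => E τ (v τ)) (volume.restrict (Ioo 0 t)) :=
    (hEL.integrable_clm_apply h.memLp_flux).mono_measure hμ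
  have hki : Integrable (fun τ => (√(F τ (J (F τ))) + √ε * ‖v τ‖) * √(E τ (J (E τ))))
      (volume.restrict (Ioo 0 t)) :=
    (((h.memLp_source.sqrt_apply_self J).add (h.memLp_flux.norm.const_mul √ε)).integrable_mul
      (hEL.sqrt_apply_self J)).mono_measure hμ
  have hle : (∫ τ in Ioo 0 t, dE τ (J (E τ))) + ∫ τ in Ioo 0 t, E τ (v τ) ≤
      ∫ τ in (0 : ℝ)..t, (√(F τ (J (F τ))) + √ε * ‖v τ‖) * √(E τ (J (E τ))) := by
    have hFB : Integrable (fun τ => F τ (J (E τ)) - B (v τ) (J (E τ)))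
        (volume.restrict (Ioo 0 t)) := hFi.sub hBi
    rw [eq_sub_of_add_eq hweak, ← integral_sub hFi hBi, ← integral_add hFB hEi,
      intervalIntegral.integral_of_le ht.1, integral_Ioc_eq_integral_Ioo]
    refine integral_mono (hFB.add hEi) hki fun τ => ?_
    have h1 : F τ (J (E τ)) ≤ √(F τ (J (F τ))) * √(E τ (J (E τ))) := by
      have := hJ.abs_apply_le hB hB0 hε (F τ) (J (E τ))
      rw [← hJ.apply_self_eq] at this
      exact (le_abs_self _).trans this
    -- The Riesz identity turns `B (v, J E)` into `⟨E, v⟩` up to the term `ε ⟪J E, v⟫`, which is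
    -- absorbed into the source.
    have h2 := hJ (E τ) (v τ)
    have h3 : ε * inner ℝ (J (E τ)) (v τ) ≤ √ε * √(E τ (J (E τ))) * ‖v τ‖ := by
      calc ε * inner ℝ (J (E τ)) (v τ) ≤ ε * (‖J (E τ)‖ * ‖v τ‖) := by
            gcongr
            exact real_inner_le_norm _ _
        _ = ε * ‖J (E τ)‖ * ‖v τ‖ := by ring
        _ ≤ _ := mul_le_mul_of_nonneg_right (hJ.norm_le hB0 hε _) (norm_nonneg _)
    have h4 := hB (v τ) (J (E τ))
    linarith
  rw [hquad']
  linarith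

/-- The estimates in the regularised dual norm. -/
theorem sqrt_le_and_integral_le (h : IsDualEvolution B T E₀ dE F v) (hB : ∀ u w, B u w = B w u)
    (hB0 : ∀ w, 0 ≤ B w w) {ε : ℝ} (hε : 0 < ε) {J : StrongDual ℝ H →L[ℝ] H}
    (hJ : IsRegularizedRiesz B ε J) {E : ℝ → StrongDual ℝ H}
    (hE : E = fun t => E₀ + ∫ τ in (0 : ℝ)..t, dE τ) {t : ℝ} (ht : t ∈ Icc 0 T) {K : ℝ}
    (hK : ∫ τ in (0 : ℝ)..t, (√(F τ (J (F τ))) + √ε * ‖v τ‖) ≤ K) :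
    √(E t (J (E t))) ≤ √(E₀ (J E₀)) + K ∧
      2 * (∫ τ in Ioo 0 t, E τ (v τ)) ≤ √(E₀ (J E₀)) ^ 2 + 2 * (K * (√(E₀ (J E₀)) + K)) := by
  have hT : 0 ≤ T := ht.1.trans ht.2
  set k : ℝ → ℝ := fun τ => √(F τ (J (F τ))) + √ε * ‖v τ‖ with hk
  set y : ℝ → ℝ := fun τ => √(E τ (J (E τ))) with hy
  have hk0 : ∀ τ, 0 ≤ k τ := fun τ => by positivity
  have hkL : MemLp k 2 (volume.restrict (Ioo 0 T)) :=
    (h.memLp_source.sqrt_apply_self J).add (h.memLp_flux.norm.const_mul √ε)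
  have hki : IntervalIntegrable k volume 0 T :=
    hkL.intervalIntegrable_of_mem_Icc ⟨hT, le_rfl⟩
  have hEc : ContinuousOn E (Icc 0 T) := hE ▸ h.continuousOn hT
  have hyc : ContinuousOn y (Icc 0 T) :=
    Real.continuous_sqrt.comp_continuousOn (hEc.clm_apply (J.continuous.comp_continuousOn hEc))
  have hDpos : ∀ r ∈ Icc 0 T, 0 ≤ ∫ τ in Ioo 0 r, E τ (v τ) := fun r hr => by
    refine integral_nonneg_of_ae
      (ae_restrict_of_ae_restrict_of_subset (Ioo_subset_Ioo_right hr.2) ?_)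
    rw [hE]
    exact h.nonneg
  have hen : ∀ r ∈ Icc 0 T, y r ^ 2 + 2 * (∫ τ in Ioo 0 r, E τ (v τ)) ≤
      √(E₀ (J E₀)) ^ 2 + 2 * ∫ τ in (0 : ℝ)..r, k τ * y τ := fun r hr => by
    rw [Real.sq_sqrt (hJ.apply_self_nonneg hB0 hε _), Real.sq_sqrt (hJ.apply_self_nonneg hB0 hε _)]
    exact h.energy_le hB hB0 hε hJ hE hr
  have hgr : ∀ r ∈ Icc 0 T, y r ≤ √(E₀ (J E₀)) + ∫ τ in (0 : ℝ)..r, k τ := fun r hr =>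
    le_add_integral_of_sq_le hyc hki hk0 (Real.sqrt_nonneg _)
      (fun r hr => by linarith [hen r hr, hDpos r hr]) hr
  have hkit : IntervalIntegrable k volume 0 t := hkL.intervalIntegrable_of_mem_Icc ht
  have hsub : Icc 0 t ⊆ Icc 0 T := Icc_subset_Icc_right ht.2
  have hyK : ∀ r ∈ Icc 0 t, y r ≤ √(E₀ (J E₀)) + K := fun r hr => by
    have : ∫ τ in (0 : ℝ)..r, k τ ≤ ∫ τ in (0 : ℝ)..t, k τ :=
      intervalIntegral.integral_mono_interval le_rfl hr.1 hr.2 (.of_forall hk0) hkit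
    linarith [hgr r (hsub hr)]
  refine ⟨hyK t ⟨ht.1, le_rfl⟩, ?_⟩
  have hky : ∫ τ in (0 : ℝ)..t, k τ * y τ ≤ K * (√(E₀ (J E₀)) + K) := by
    calc ∫ τ in (0 : ℝ)..t, k τ * y τ ≤ ∫ τ in (0 : ℝ)..t, k τ * (√(E₀ (J E₀)) + K) := by
          refine intervalIntegral.integral_mono_on ht.1
            (hkit.mul_continuousOn (by rw [uIcc_of_le ht.1]; exact hyc.mono hsub))
            (hkit.mul_const _) fun τ hτ => mul_le_mul_of_nonneg_left (hyK τ hτ) (hk0 τ)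
      _ = (∫ τ in (0 : ℝ)..t, k τ) * (√(E₀ (J E₀)) + K) :=
          intervalIntegral.integral_mul_const _ _
      _ ≤ _ := mul_le_mul_of_nonneg_right hK
          ((Real.sqrt_nonneg _).trans (hyK t ⟨ht.1, le_rfl⟩))
  have := hen t ht
  nlinarith [sq_nonneg (y t)]

/-- Uniform in `ε` apart from the explicit `√ε` term. Only monotonicity of the lower integral is
used for the dual norm, so its measurability in time is not needed. -/
theorem integral_regularized_le (h : IsDualEvolution B T E₀ dE F v) (hB0 : ∀ w, 0 ≤ B w w) {ε : ℝ}
    (hε : 0 < ε) {J : StrongDual ℝ H →L[ℝ] H} (hJ : IsRegularizedRiesz B ε J) {t : ℝ}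
    (ht : t ∈ Icc 0 T) (hfin : ∫⁻ τ in Ioo 0 t, formDualNorm B (F τ) ≠ ⊤) :
    ∫ τ in (0 : ℝ)..t, (√(F τ (J (F τ))) + √ε * ‖v τ‖) ≤
      (∫⁻ τ in Ioo 0 t, formDualNorm B (F τ)).toReal + √ε * ∫ τ in Ioo 0 t, ‖v τ‖ := by
  have hμ : volume.restrict (Ioo 0 t) ≤ volume.restrict (Ioo 0 T) :=
    Measure.restrict_mono (Ioo_subset_Ioo_right ht.2) le_rfl
  have h1 := ((h.memLp_source.sqrt_apply_self J).mono_measure hμ).integrable one_le_two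
  have h2 := (h.memLp_flux.norm.mono_measure hμ).integrable one_le_two
  rw [intervalIntegral.integral_of_le ht.1, integral_Ioc_eq_integral_Ioo,
    integral_add h1 (h2.const_mul _), integral_const_mul,
    integral_eq_lintegral_of_nonneg_ae (.of_forall fun _ => Real.sqrt_nonneg _)
      h1.aestronglyMeasurable]
  gcongr
  exact hJ.ofReal_sqrt_le hB0 hε _

/-- Continuous dependence in the dual norm. -/
theorem formDualNorm_le [CompleteSpace H] (h : IsDualEvolution B T E₀ dE F v)
    (hB : ∀ u w, B u w = B w u) (hB0 : ∀ w, 0 ≤ B w w) {t : ℝ} (ht : t ∈ Icc 0 T) :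
    formDualNorm B (E₀ + ∫ τ in (0 : ℝ)..t, dE τ) ≤
      formDualNorm B E₀ + ∫⁻ τ in Ioo 0 t, formDualNorm B (F τ) := by
  by_cases hn : formDualNorm B E₀ = ⊤
  · simp [hn]
  by_cases hI : ∫⁻ τ in Ioo 0 t, formDualNorm B (F τ) = ⊤
  · simp [hI]
  set n := (formDualNorm B E₀).toReal
  set I := (∫⁻ τ in Ioo 0 t, formDualNorm B (F τ)).toReal
  set V := ∫ τ in Ioo 0 t, ‖v τ‖
  refine iSup₂_le fun w hw => ?_
  rw [Real.enorm_eq_ofReal_abs, ENNReal.ofReal_le_iff_le_toReal (by finiteness),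
    ENNReal.toReal_add hn hI]
  -- The limit is taken for each fixed `w`, before the supremum, since the last factor depends on
  -- `‖w‖`.
  have hlim : Filter.Tendsto (fun ε : ℝ => (n + (I + √ε * V)) * √(1 + ε * ‖w‖ ^ 2))
      (nhdsWithin 0 (Ioi 0)) (nhds (n + I)) := by
    have : Continuous fun ε : ℝ => (n + (I + √ε * V)) * √(1 + ε * ‖w‖ ^ 2) := by fun_prop
    simpa using (this.tendsto 0).mono_left nhdsWithin_le_nhds
  refine ge_of_tendsto hlim ?_
  filter_upwards [self_mem_nhdsWithin] with ε hε
  obtain ⟨J, hJ⟩ := exists_isRegularizedRiesz hB0 hε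
  have hq0 : √(E₀ (J E₀)) ≤ n :=
    (ENNReal.ofReal_le_iff_le_toReal hn).mp (hJ.ofReal_sqrt_le hB0 hε E₀)
  have hq := (h.sqrt_le_and_integral_le hB hB0 hε hJ rfl ht
    (h.integral_regularized_le hB0 hε hJ ht hI)).1
  refine (hJ.abs_apply_le hB hB0 hε _ w).trans ?_
  gcongr
  exact hq.trans (by gcongr)

theorem integral_apply_le [CompleteSpace H] (h : IsDualEvolution B T E₀ dE F v) (hT : 0 ≤ T)
    (hB : ∀ u w, B u w = B w u) (hB0 : ∀ w, 0 ≤ B w w) (hn : formDualNorm B E₀ ≠ ⊤)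
    (hI : ∫⁻ τ in Ioo 0 T, formDualNorm B (F τ) ≠ ⊤) :
    ∫ τ in Ioo 0 T, (E₀ + ∫ σ in (0 : ℝ)..τ, dE σ) (v τ) ≤
      ((formDualNorm B E₀).toReal +
        √(3 / 2) * (∫⁻ τ in Ioo 0 T, formDualNorm B (F τ)).toReal) ^ 2 := by
  set n := (formDualNorm B E₀).toReal
  set I := (∫⁻ τ in Ioo 0 T, formDualNorm B (F τ)).toReal
  set V := ∫ τ in Ioo 0 T, ‖v τ‖
  have hn0 : 0 ≤ n := ENNReal.toReal_nonneg
  have hI0 : 0 ≤ I := ENNReal.toReal_nonneg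
  have hV0 : 0 ≤ V := integral_nonneg fun _ => norm_nonneg _
  have hlim : Filter.Tendsto
      (fun ε : ℝ => n ^ 2 + 2 * ((I + √ε * V) * (n + (I + √ε * V))))
      (nhdsWithin 0 (Ioi 0)) (nhds (n ^ 2 + 2 * (I * (n + I)))) := by
    have : Continuous fun ε : ℝ => n ^ 2 + 2 * ((I + √ε * V) * (n + (I + √ε * V))) := by fun_prop
    simpa using (this.tendsto 0).mono_left nhdsWithin_le_nhds
  have hD : 2 * ∫ τ in Ioo 0 T, (E₀ + ∫ σ in (0 : ℝ)..τ, dE σ) (v τ) ≤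
      n ^ 2 + 2 * (I * (n + I)) := by
    refine ge_of_tendsto hlim ?_
    filter_upwards [self_mem_nhdsWithin] with ε hε
    obtain ⟨J, hJ⟩ := exists_isRegularizedRiesz hB0 hε
    have hq0 : √(E₀ (J E₀)) ≤ n :=
      (ENNReal.ofReal_le_iff_le_toReal hn).mp (hJ.ofReal_sqrt_le hB0 hε E₀)
    refine (h.sqrt_le_and_integral_le hB hB0 hε hJ rfl ⟨hT, le_rfl⟩
      (h.integral_regularized_le hB0 hε hJ ⟨hT, le_rfl⟩ hI)).2.trans ?_
    gcongr
  -- The bound just obtained, `n²/2 + n I + I²`, is already at most `(n + I)²`; the constant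
  -- `√(3/2)` leaves room.
  have hs : √(3 / 2 : ℝ) ^ 2 = 3 / 2 := Real.sq_sqrt (by norm_num)
  have hs1 : 1 ≤ √(3 / 2 : ℝ) := Real.one_le_sqrt.mpr (by norm_num)
  have hnI : n * I ≤ √(3 / 2) * (n * I) := le_mul_of_one_le_left (by positivity) hs1
  have hexp : (n + √(3 / 2) * I) ^ 2 = n ^ 2 + 2 * (√(3 / 2) * (n * I)) + 3 / 2 * I ^ 2 := by
    linear_combination I ^ 2 * hs
  rw [hexp]
  nlinarith [mul_nonneg hn0 hI0]

end IsDualEvolution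

end DualEvolution

/-! ### Application to the fractional Stefan problem. -/

namespace FracStefan

variable {d : ℕ} {A : Rd d → Matrix (Fin d) (Fin d) ℝ} {a b : ℝ}

theorem completeSpace_Hs0 (s : ℝ) (Ω : Set (Rd d)) : CompleteSpace (Hs0 s Ω) :=
  (Submodule.isClosed_topologicalClosure _).completeSpace_coe

theorem embed_sub_apply_sub (s : ℝ) {Ω : Set (Rd d)} (h h₁ : L2 Ω) (w w₁ : Hs0 s Ω) :
    (embed s Ω h - embed s Ω h₁) (w - w₁) = inner ℝ (h - h₁) (restr Ω w - restr Ω w₁) := by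
  rw [← map_sub, inner_sub_left]
  rfl

section EnergyForm

theorem inner_toEuclideanLin_comm {M : Matrix (Fin d) (Fin d) ℝ} (hM : M.IsSymm) (z w : Rd d) :
    inner ℝ (Matrix.toEuclideanLin M z) w = inner ℝ (Matrix.toEuclideanLin M w) z := by
  have hH : M.IsHermitian := by
    rw [Matrix.IsHermitian, Matrix.conjTranspose_eq_transpose_of_trivial]
    exact hM
  rw [(Matrix.isSymmetric_toEuclideanLin_iff.mpr hH) z w, real_inner_comm]

/-- Cauchy–Schwarz for the semidefinite form of `M`, at `z` and `w = M z`: `‖w‖⁴ ≤ (M z · z)(M w ·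
w)`. The absolute value appears because `0 ≤ b` is not assumed. -/
theorem norm_toEuclideanLin_le {M : Matrix (Fin d) (Fin d) ℝ} (hM : M.IsSymm)
    (h0 : ∀ z : Rd d, 0 ≤ inner ℝ (Matrix.toEuclideanLin M z) z)
    (hb : ∀ z : Rd d, inner ℝ (Matrix.toEuclideanLin M z) z ≤ b * ‖z‖ ^ 2) (z : Rd d) :
    ‖Matrix.toEuclideanLin M z‖ ≤ |b| * ‖z‖ := by
  let B : LinearMap.BilinForm ℝ (Rd d) := (innerₗ (Rd d)).comp (Matrix.toEuclideanLin M)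
  have hB : ∀ u v, B u v = inner ℝ (Matrix.toEuclideanLin M u) v := fun _ _ => rfl
  set w := Matrix.toEuclideanLin M z with hw
  have hcs := B.apply_sq_le_of_symm h0 ⟨fun u v => inner_toEuclideanLin_comm hM u v⟩ z w
  rw [hB, hB, hB, ← hw, real_inner_self_eq_norm_sq] at hcs
  have h1 : (‖w‖ ^ 2) ^ 2 ≤ (b * ‖z‖ ^ 2) * (b * ‖w‖ ^ 2) :=
    hcs.trans (mul_le_mul (hb z) (hb w) (h0 w) ((h0 z).trans (hb z)))
  have h2 : ‖w‖ ^ 2 ≤ |b| * ‖z‖ * ‖w‖ := by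
    refine abs_le_of_sq_le_sq' ?_ (by positivity) |>.2
    calc (‖w‖ ^ 2) ^ 2 ≤ (b * ‖z‖ ^ 2) * (b * ‖w‖ ^ 2) := h1
      _ = b ^ 2 * ‖z‖ ^ 2 * ‖w‖ ^ 2 := by ring
      _ = _ := by rw [mul_pow, mul_pow, sq_abs]
  rcases (norm_nonneg w).eq_or_lt with h | h
  · rw [← h]; positivity
  · nlinarith

theorem IsElliptic.nonneg (hA : IsElliptic A a b) :
    ∀ᵐ x, ∀ z : Rd d, 0 ≤ inner ℝ (Matrix.toEuclideanLin (A x) z) z := by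
  filter_upwards [hA.bounds] with x hx z
  exact (mul_nonneg hA.pos.le (sq_nonneg _)).trans (hx z).1

theorem IsElliptic.norm_apply_le (hA : IsElliptic A a b) :
    ∀ᵐ x, ∀ z : Rd d, ‖Matrix.toEuclideanLin (A x) z‖ ≤ |b| * ‖z‖ := by
  filter_upwards [hA.symm, hA.nonneg, hA.bounds] with x hs h0 hb
  exact norm_toEuclideanLin_le hs h0 fun z => (hb z).2

theorem IsElliptic.aestronglyMeasurable_apply (hA : IsElliptic A a b) {u : Rd d → Rd d}
    (hu : AEStronglyMeasurable u volume) :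
    AEStronglyMeasurable (fun x => Matrix.toEuclideanLin (A x) (u x)) volume := by
  refine AEMeasurable.aestronglyMeasurable ?_
  refine (PiLp.continuous_toLp 2 _).measurable.comp_aemeasurable
    (aemeasurable_pi_lambda _ fun i => ?_)
  change AEMeasurable (fun x => ∑ j, A x i j * u x j) volume
  refine Finset.aemeasurable_fun_sum _ fun j _ => (hA.measurable i j).aemeasurable.mul ?_
  exact ((PiLp.continuous_ofLp 2 _).measurable.comp_aemeasurable hu.aemeasurable).eval j

theorem IsElliptic.memLp_apply (hA : IsElliptic A a b)
    (u : Lp (Rd d) 2 (volume : Measure (Rd d))) :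
    MemLp (fun x => Matrix.toEuclideanLin (A x) (u x)) 2 volume := by
  refine (Lp.memLp u).of_le_mul (hA.aestronglyMeasurable_apply (Lp.aestronglyMeasurable u))
    (c := |b|) ?_
  filter_upwards [hA.norm_apply_le] with x hx using hx (u x)

/-- Multiplication by the matrix field `A` on `L²(ℝ^d)^d`. -/
noncomputable def matrixMul (hA : IsElliptic A a b) :
    Lp (Rd d) 2 (volume : Measure (Rd d)) →L[ℝ] Lp (Rd d) 2 (volume : Measure (Rd d)) :=
  LinearMap.mkContinuous
    { toFun := fun u => (hA.memLp_apply u).toLp _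
      map_add' := fun u v => by
        rw [← MemLp.toLp_add]
        refine MemLp.toLp_congr _ _ ?_
        filter_upwards [Lp.coeFn_add u v] with x hx
        exact (congrArg (Matrix.toEuclideanLin (A x)) hx).trans (map_add _ _ _)
      map_smul' := fun c u => by
        rw [RingHom.id_apply, ← MemLp.toLp_const_smul]
        refine MemLp.toLp_congr _ _ ?_
        filter_upwards [Lp.coeFn_smul c u] with x hx
        exact (congrArg (Matrix.toEuclideanLin (A x)) hx).trans (LinearMap.map_smul _ c (u x)) }
    |b| fun u => by
      refine Lp.norm_le_mul_norm_of_ae_le_mul ?_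
      filter_upwards [(hA.memLp_apply u).coeFn_toLp, hA.norm_apply_le] with x hx hb
      exact (congrArg norm hx).trans_le (hb (u x))

theorem matrixMul_coeFn (hA : IsElliptic A a b) (u : Lp (Rd d) 2 (volume : Measure (Rd d))) :
    matrixMul hA u =ᵐ[volume] fun x => Matrix.toEuclideanLin (A x) (u x) :=
  (hA.memLp_apply u).coeFn_toLp

/-- The form `[·,·]_A` on `H^s_0(Ω)`. -/
noncomputable def energyForm (hA : IsElliptic A a b) (s : ℝ) (Ω : Set (Rd d)) :
    Hs0 s Ω →L[ℝ] Hs0 s Ω →L[ℝ] ℝ :=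
  let I : Lp (Rd d) 2 (volume : Measure (Rd d)) →L[ℝ]
    Lp (Rd d) 2 (volume : Measure (Rd d)) →L[ℝ] ℝ := innerSL ℝ
  let D : Hs0 s Ω →L[ℝ] Lp (Rd d) 2 (volume : Measure (Rd d)) :=
    (WithLp.sndL 2 ℝ _ _).comp (Hs0 s Ω).subtypeL
  I.bilinearComp ((matrixMul hA).comp D) D

variable {s : ℝ} {Ω : Set (Rd d)}

theorem energyForm_apply (hA : IsElliptic A a b) (u v : Hs0 s Ω) :
    energyForm hA s Ω u v = energy A u v := by
  change inner ℝ (matrixMul hA (u : Pairs d).snd) (v : Pairs d).snd = _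
  rw [L2.inner_def, energy]
  refine integral_congr_ae ?_
  filter_upwards [matrixMul_coeFn hA (u : Pairs d).snd] with x hx
  rw [hx]

theorem energyForm_comm (hA : IsElliptic A a b) (u v : Hs0 s Ω) :
    energyForm hA s Ω u v = energyForm hA s Ω v u := by
  rw [energyForm_apply, energyForm_apply]
  refine integral_congr_ae ?_
  filter_upwards [hA.symm] with x hx
  exact inner_toEuclideanLin_comm hx _ _

theorem energyForm_self_nonneg (hA : IsElliptic A a b) (u : Hs0 s Ω) :
    0 ≤ energyForm hA s Ω u u := by
  rw [energyForm_apply]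
  refine integral_nonneg_of_ae ?_
  filter_upwards [hA.nonneg] with x hx
  exact hx _

theorem dualNorm_eq_formDualNorm (hA : IsElliptic A a b) (F : HNeg s Ω) :
    dualNorm A F = formDualNorm (energyForm hA s Ω) F := by
  simp only [dualNorm, formDualNorm, energyForm_apply]

end EnergyForm

section Temperature

variable {Ω : Set (Rd d)} {γ : ℝ → ℝ} {C : ℝ≥0}

theorem IsTwoPhaseLaw.inner_nonneg (hγ : IsTwoPhaseLaw γ C) (p q : ℝ) :
    0 ≤ inner ℝ (p - q) (γ p - γ q) := by
  rw [Real.inner_apply]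
  rcases le_total p q with h | h
  · exact mul_nonneg_of_nonpos_of_nonpos (by linarith) (by linarith [hγ.mono h])
  · exact mul_nonneg (by linarith) (by linarith [hγ.mono h])

/-- The Lipschitz bound is applied to one of the two factors; monotonicity lets the absolute value
of the remaining product be dropped. -/
theorem IsTwoPhaseLaw.norm_sub_sq_le (hγ : IsTwoPhaseLaw γ C) (p q : ℝ) :
    ‖γ p - γ q‖ ^ 2 ≤ C * inner ℝ (p - q) (γ p - γ q) := by
  have hl : |γ p - γ q| ≤ C * |p - q| := by
    simpa [Real.dist_eq] using hγ.lipschitz.dist_le_mul p q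
  rw [← abs_of_nonneg (hγ.inner_nonneg p q), Real.inner_apply, abs_mul, ← mul_assoc, sq,
    Real.norm_eq_abs]
  gcongr

/-- The law `γ` is cocoercive on `L²(Ω)`. -/
theorem norm_temperature_sub_sq_le (hγ : IsTwoPhaseLaw γ C) (η η₁ : L2 Ω) :
    ‖temperature hγ η - temperature hγ η₁‖ ^ 2 ≤
      C * inner ℝ (η - η₁) (temperature hγ η - temperature hγ η₁) := by
  rw [← real_inner_self_eq_norm_sq, ← real_inner_smul_left, L2.inner_def, L2.inner_def]
  refine integral_mono_ae (L2.integrable_inner _ _) (L2.integrable_inner _ _) ?_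
  filter_upwards [Lp.coeFn_sub η η₁, Lp.coeFn_sub (temperature hγ η) (temperature hγ η₁),
    Lp.coeFn_smul (C : ℝ) (η - η₁), hγ.lipschitz.coeFn_compLp hγ.map_zero η,
    hγ.lipschitz.coeFn_compLp hγ.map_zero η₁] with x h1 h2 h3 h4 h5
  have h4' : temperature hγ η x = γ (η x) := h4
  have h5' : temperature hγ η₁ x = γ (η₁ x) := h5
  rw [h2, h3, Pi.smul_apply, h1, Pi.sub_apply, Pi.sub_apply, h4', h5', real_inner_smul_left,
    real_inner_self_eq_norm_sq]
  exact hγ.norm_sub_sq_le (η x) (η₁ x)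

theorem inner_temperature_sub_nonneg (hγ : IsTwoPhaseLaw γ C) (η η₁ : L2 Ω) :
    0 ≤ inner ℝ (η - η₁) (temperature hγ η - temperature hγ η₁) := by
  rw [L2.inner_def]
  refine integral_nonneg_of_ae ?_
  filter_upwards [Lp.coeFn_sub η η₁, Lp.coeFn_sub (temperature hγ η) (temperature hγ η₁),
    hγ.lipschitz.coeFn_compLp hγ.map_zero η,
    hγ.lipschitz.coeFn_compLp hγ.map_zero η₁] with x h1 h2 h3 h4
  have h3' : temperature hγ η x = γ (η x) := h3
  have h4' : temperature hγ η₁ x = γ (η₁ x) := h4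
  rw [h1, h2, Pi.sub_apply, Pi.sub_apply, h3', h4']
  exact hγ.inner_nonneg _ _

end Temperature

section Comparison

variable {s T : ℝ} {Ω : Set (Rd d)}
  {γ : ℝ → ℝ} {C : ℝ≥0} {g : ℝ → Pairs d} {f f₁ : ℝ → HNeg s Ω} {η₀ η₁₀ : L2 Ω}
  {η η₁ : ℝ → L2 Ω} {ηc η₁c : ℝ → HNeg s Ω}

/-- The difference of two enthalpy solutions is an evolution in the dual of `H^s_0(Ω)`. -/
theorem IsEnthalpySolution.exists_isDualEvolution_sub (hA : IsElliptic A a b)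
    (hγ : IsTwoPhaseLaw γ C)
    (hf : MemLp f 2 (timeMeasure T)) (hf₁ : MemLp f₁ 2 (timeMeasure T))
    (hη : IsEnthalpySolution s T Ω A hγ f g η₀ η ηc)
    (hη₁ : IsEnthalpySolution s T Ω A hγ f₁ g η₁₀ η₁ η₁c) :
    ∃ (dE : ℝ → HNeg s Ω) (v : ℝ → Hs0 s Ω),
      IsDualEvolution (energyForm hA s Ω) T (embed s Ω η₀ - embed s Ω η₁₀) dE
        (fun t => f t - f₁ t) v ∧
      (∀ t ∈ Icc 0 T, ηc t - η₁c t =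
        embed s Ω η₀ - embed s Ω η₁₀ + ∫ τ in (0 : ℝ)..t, dE τ) ∧
      ∀ᵐ t ∂timeMeasure T,
        (embed s Ω η₀ - embed s Ω η₁₀ + ∫ τ in (0 : ℝ)..t, dE τ) (v t) =
          inner ℝ (η t - η₁ t) (temperature hγ (η t) - temperature hγ (η₁ t)) := by
  obtain ⟨dη, w, hdη, hprim, hw, hwθ, heq⟩ := hη.eqn
  obtain ⟨dη₁, w₁, hdη₁, hprim₁, hw₁, hwθ₁, heq₁⟩ := hη₁.eqn
  have hE := primitive_sub_primitive hdη hdη₁ hprim hprim₁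
  rw [hη.initial, hη₁.initial] at hE
  have hpair : ∀ᵐ t ∂timeMeasure T,
      (embed s Ω η₀ - embed s Ω η₁₀ + ∫ τ in (0 : ℝ)..t, (dη τ - dη₁ τ)) (w t - w₁ t) =
        inner ℝ (η t - η₁ t) (temperature hγ (η t) - temperature hγ (η₁ t)) := by
    filter_upwards [ae_restrict_mem measurableSet_Ioo, hη.rep, hη₁.rep, hwθ, hwθ₁]
      with t ht hr hr₁ hθ hθ₁
    -- The duality pairing becomes an `L²(Ω)` inner product, in which the common datum `g` cancels.
    rw [← hE t (Ioo_subset_Icc_self ht), hr, hr₁, embed_sub_apply_sub, hθ, hθ₁,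
      sub_sub_sub_cancel_right]
  simp only [← energyForm_apply hA] at heq heq₁
  refine ⟨fun t => dη t - dη₁ t, fun t => w t - w₁ t,
    .of_sub hdη hdη₁ hf hf₁ hw hw₁ heq heq₁ ?_, hE, hpair⟩
  filter_upwards [hpair] with t ht
  rw [ht]
  exact inner_temperature_sub_nonneg hγ _ _

theorem eLpNorm_two_le_of_norm_sq_le {α X : Type*} [MeasurableSpace α] {μ : Measure α}
    [NormedAddCommGroup X] {θ : α → X} {D : α → ℝ} {c M : ℝ} (hc : 0 ≤ c) (hM : 0 ≤ M)
    (hD : Integrable D μ) (hD0 : 0 ≤ᵐ[μ] D) (hθ : ∀ᵐ t ∂μ, ‖θ t‖ ^ 2 ≤ c * D t)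
    (hDM : ∫ t, D t ∂μ ≤ M ^ 2) : eLpNorm θ 2 μ ≤ ENNReal.ofReal (√c * M) := by
  rw [eLpNorm_eq_lintegral_rpow_enorm_toReal two_ne_zero ENNReal.ofNat_ne_top,
    ENNReal.toReal_ofNat]
  have hle : ∫⁻ t, ‖θ t‖ₑ ^ (2 : ℝ) ∂μ ≤ ENNReal.ofReal ((√c * M) ^ 2) := by
    calc ∫⁻ t, ‖θ t‖ₑ ^ (2 : ℝ) ∂μ ≤ ∫⁻ t, ENNReal.ofReal (c * D t) ∂μ := by
          refine lintegral_mono_ae ?_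
          filter_upwards [hθ] with t ht
          rw [ENNReal.rpow_two, ← ofReal_norm, ← ENNReal.ofReal_pow (norm_nonneg _)]
          exact ENNReal.ofReal_le_ofReal ht
      _ = ENNReal.ofReal (∫ t, c * D t ∂μ) := by
          refine (ofReal_integral_eq_lintegral_ofReal (hD.const_mul c) ?_).symm
          filter_upwards [hD0] with t ht using mul_nonneg hc ht
      _ ≤ _ := by
          rw [integral_const_mul, mul_pow, Real.sq_sqrt hc]
          gcongr
  refine (ENNReal.rpow_le_rpow hle (by norm_num)).trans_eq ?_
  rw [ENNReal.ofReal_pow (by positivity), ← ENNReal.rpow_two, ← ENNReal.rpow_mul]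
  norm_num

end Comparison

end FracStefan

theorem proposition2p3 {d : ℕ} (hd : 0 < d) {s T : ℝ} (hs : 0 < s) (hs1 : s ≤ 1) (hT : 0 < T)
    {Ω : Set (FracStefan.Rd d)} (hΩ : IsOpen Ω) (hΩb : Bornology.IsBounded Ω)
    {A : FracStefan.Rd d → Matrix (Fin d) (Fin d) ℝ} {a b : ℝ} (hA : FracStefan.IsElliptic A a b)
    {γ : ℝ → ℝ} {C : ℝ≥0} (hγ : FracStefan.IsTwoPhaseLaw γ C)
    {g' g : ℝ → FracStefan.Pairs d} (hg : FracStefan.IsDirichletDatum s T Ω A g' g)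
    {f f₁ : ℝ → FracStefan.HNeg s Ω}
    (hf : MemLp f 2 (FracStefan.timeMeasure T)) (hf₁ : MemLp f₁ 2 (FracStefan.timeMeasure T))
    {η₀ η₁₀ : FracStefan.L2 Ω} {η η₁ : ℝ → FracStefan.L2 Ω} {ηc η₁c : ℝ → FracStefan.HNeg s Ω}
    (hη : FracStefan.IsEnthalpySolution s T Ω A hγ f g η₀ η ηc)
    (hη₁ : FracStefan.IsEnthalpySolution s T Ω A hγ f₁ g η₁₀ η₁ η₁c) :
    (∀ t ∈ Icc 0 T,
      FracStefan.dualNorm A (ηc t - η₁c t) ≤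
        FracStefan.dualNorm A (FracStefan.embed s Ω η₀ - FracStefan.embed s Ω η₁₀) +
          ∫⁻ τ in Ioo 0 t, FracStefan.dualNorm A (f τ - f₁ τ)) ∧
    eLpNorm (fun t => FracStefan.temperature hγ (η t) - FracStefan.temperature hγ (η₁ t)) 2
        (FracStefan.timeMeasure T) ≤
      ENNReal.ofReal (√(C : ℝ)) *
          FracStefan.dualNorm A (FracStefan.embed s Ω η₀ - FracStefan.embed s Ω η₁₀) +
        ENNReal.ofReal (√(3 * (C : ℝ) / 2)) *
          ∫⁻ τ in Ioo 0 T, FracStefan.dualNorm A (f τ - f₁ τ) := by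

  have := FracStefan.completeSpace_Hs0 s Ω
  obtain ⟨dE, v, hev, hE, hpair⟩ := hη.exists_isDualEvolution_sub hA hγ hf hf₁ hη₁
  have hB := FracStefan.energyForm_comm hA (s := s) (Ω := Ω)
  have hB0 := FracStefan.energyForm_self_nonneg hA (s := s) (Ω := Ω)
  simp only [FracStefan.dualNorm_eq_formDualNorm hA]
  refine ⟨fun t ht => ?_, ?_⟩
  · rw [hE t ht]
    exact hev.formDualNorm_le hB hB0 ht
  have hθ : ∀ᵐ t ∂FracStefan.timeMeasure T,
      ‖FracStefan.temperature hγ (η t) - FracStefan.temperature hγ (η₁ t)‖ ^ 2 ≤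
        C * (FracStefan.embed s Ω η₀ - FracStefan.embed s Ω η₁₀ +
          ∫ τ in (0 : ℝ)..t, dE τ) (v t) := by
    filter_upwards [hpair] with t ht
    rw [ht]
    exact FracStefan.norm_temperature_sub_sq_le hγ _ _
  -- For `C = 0` the convention `0 * ⊤ = 0` makes the right side zero even when a dual norm is
  -- infinite, so the temperature difference has to be shown to vanish.
  rcases eq_or_ne C 0 with rfl | hC
  · have h0 : (fun t => FracStefan.temperature hγ (η t) - FracStefan.temperature hγ (η₁ t))
        =ᵐ[FracStefan.timeMeasure T] 0 := by
      filter_upwards [hθ] with t ht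
      simpa using ht
    simp [eLpNorm_congr_ae h0]
  have hC0 : (0 : ℝ) < C := by positivity
  by_cases hn : formDualNorm (FracStefan.energyForm hA s Ω)
      (FracStefan.embed s Ω η₀ - FracStefan.embed s Ω η₁₀) = ⊤
  · rw [hn, ENNReal.mul_top (by simpa using hC0), top_add]
    exact le_top
  by_cases hI : ∫⁻ τ in Ioo 0 T, formDualNorm (FracStefan.energyForm hA s Ω) (f τ - f₁ τ) = ⊤
  · rw [hI, ENNReal.mul_top (by simpa using hC0), add_top]
    exact le_top
  refine (FracStefan.eLpNorm_two_le_of_norm_sq_le hC0.le (by positivity)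
    ((hev.memLp hT.le).integrable_clm_apply hev.memLp_flux) hev.nonneg hθ
    (hev.integral_apply_le hT.le hB hB0 hn hI)).trans_eq ?_
  rw [mul_add, ENNReal.ofReal_add (by positivity) (by positivity),
    ENNReal.ofReal_mul (Real.sqrt_nonneg _), ENNReal.ofReal_toReal hn, ← mul_assoc,
    ← Real.sqrt_mul hC0.le, ENNReal.ofReal_mul (Real.sqrt_nonneg _), ENNReal.ofReal_toReal hI]
  congr 4
  ring
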